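/- An integer $d$ is a fundamental discriminant if $d=1$ or $d$ is the discriminant of a quadratic number field. For a cubic number field $K$ with ring of integers $R_K$, the trace form $z\mapsto \mathrm{Tr}(z^2)$ on the trace-zero part of $\mathbb{Z}+3R_K$ can be written, in a $\mathbb{Z}$-basis, as $nQ(x,y)$ with $n$ a positive integer and $Q$ a primitive integral binary quadratic form; the $\mathrm{GL}_2(\mathbb{Z})$-equivalence class of $Q$ is called the shape of $R_K$, and the discriminant $s^2-4rt$ of $Q=rx^2+sxy+ty^2$ is the discriminant of the shape. The quadratic resolvent field of $K$ is $\mathbb{Q}(\sqrt{\mathrm{Disc}(K)})$ (which is $\mathbb{Q}$ if $K$ is Galois). For integers $d, D$ and real $X$, let $N(d,X)$ be the number of isomorphism classes of cubic fields $K$ with $|\mathrm{Disc}(K)|<X$ and quadratic resolvent field $\mathbb{Q}(\sqrt{d})$, and let $M_3^{D}(X)$ be the number of isomorphism classes of cubic fields $K$ with $|\mathrm{Disc}(K)|<X$ such that $R_K$ has shape of discriminant $D$. Theorem. Let $d\neq -3$ be a fundamental discriminant and let $X$ be a real number. Then $N(d,X)$ is finite and $$N(d,X)=\begin{cases} M_3^{-3d}(X)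 & \text{if } 3\nmid d,\\ M_3^{-3d}(X)+M_3^{-d/3}(X) & \text{if } 3\mid d.\end{cases}$$ -/

import Mathlib

open scoped NumberField

/-- A fundamental discriminant: `1` or the discriminant of a quadratic number field. Equivalently,
`d ≡ 1 (mod 4)` is squarefree, or `d = 4m` with `m ≡ 2, 3 (mod 4)` squarefree. -/
def IsFundamentalDiscriminant (d : ℤ) : Prop :=
  (d % 4 = 1 ∧ Squarefree d) ∨ ∃ m : ℤ, d = 4 * m ∧ (m % 4 = 2 ∨ m % 4 = 3) ∧ Squarefree m

/-- An integral binary quadratic form `r x² + s x y + t y²`. -/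
@[ext]
structure BinQuadForm where
  r : ℤ
  s : ℤ
  t : ℤ

namespace BinQuadForm

/-- The value of the form at `(x, y)`. -/
def eval (Q : BinQuadForm) (x y : ℤ) : ℤ := Q.r * x ^ 2 + Q.s * (x * y) + Q.t * y ^ 2

/-- The discriminant `s² - 4 r t`. -/
def disc (Q : BinQuadForm) : ℤ := Q.s ^ 2 - 4 * Q.r * Q.t

/-- The coefficients have no common factor apart from `±1`. -/
def IsPrimitive (Q : BinQuadForm) : Prop := ∀ k : ℤ, k ∣ Q.r → k ∣ Q.s → k ∣ Q.t → IsUnit k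

end BinQuadForm

/-- The trace-zero part of the subring `ℤ + 3R` of `R`, as a lattice. -/
noncomputable def traceZeroLattice (R : Type*) [CommRing R] : Submodule ℤ R :=
  LinearMap.ker (Algebra.trace ℤ R) ⊓
    (Submodule.span ℤ {(1 : R)} ⊔ LinearMap.range (LinearMap.mulLeft ℤ (3 : R)))

/-- The shape of a cubic ring `R` (of nonzero discriminant), as a class of binary quadratic forms:
the primitive integral forms `Q` such that, in some `ℤ`-basis `v 0, v 1` of the trace-zero part of
`ℤ + 3R`, the trace form `Tr (z²)` is `n Q(x, y)` with `n` a positive integer. Since all bases are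
allowed, this is a full `GL₂(ℤ)`-equivalence class. -/
def shape (R : Type*) [CommRing R] : Set BinQuadForm :=
  {Q | Q.IsPrimitive ∧ ∃ (v : Module.Basis (Fin 2) ℤ (traceZeroLattice R)) (n : ℤ), 0 < n ∧
    ∀ x y : ℤ, Algebra.trace ℤ R ((x • (v 0 : R) + y • (v 1 : R)) ^ 2) = n * Q.eval x y}

/-- The shape of `R` has discriminant `D`. -/
def HasShapeOfDisc (R : Type*) [CommRing R] (D : ℤ) : Prop := ∃ Q ∈ shape R, Q.disc = D

/-- The field `ℚ(√m)`, as a subfield of `ℂ`. -/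
noncomputable def sqrtField (m : ℤ) : IntermediateField ℚ ℂ :=
  IntermediateField.adjoin ℚ {z : ℂ | z ^ 2 = (m : ℂ)}

/-- A cubic number field. -/
structure CubicField where
  carrier : Type
  [field : Field carrier]
  [numberField : NumberField carrier]
  finrank_eq : Module.finrank ℚ carrier = 3

namespace CubicField

instance : CoeSort CubicField Type := ⟨CubicField.carrier⟩
instance (K : CubicField) : Field K := K.field
instance (K : CubicField) : NumberField K := K.numberField

/-- Isomorphism of cubic fields. -/
instance isoSetoid : Setoid CubicField where
  r K L := Nonempty (K ≃+* L)
  iseqv :=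
    ⟨fun _ => ⟨RingEquiv.refl _⟩, fun ⟨e⟩ => ⟨e.symm⟩, fun ⟨e⟩ ⟨f⟩ => ⟨e.trans f⟩⟩

/-- The quadratic resolvent field `ℚ(√Disc(K))` of `K` (equal to `ℚ` if `K` is Galois). -/
noncomputable def quadraticResolvent (K : CubicField) : IntermediateField ℚ ℂ :=
  sqrtField (NumberField.discr K)

end CubicField

/-- The number of cubic fields, up to isomorphism, with the property `P`. -/
noncomputable def countCubicFields (P : CubicField → Prop) : ℕ∞ :=
  {c : Quotient CubicField.isoSetoid | ∃ K : CubicField, ⟦K⟧ = c ∧ P K}.encard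

/-- `N(d, X)`: the number of cubic fields `K` with `|Disc(K)| < X` whose quadratic resolvent field
is `ℚ(√d)`. -/
noncomputable def resolventCount (d : ℤ) (X : ℝ) : ℕ∞ :=
  countCubicFields fun K =>
    |(NumberField.discr K : ℝ)| < X ∧ K.quadraticResolvent = sqrtField d

/-- `M₃^D(X)`: the number of cubic fields `K` with `|Disc(K)| < X` whose ring of integers has shape
of discriminant `D`. -/
noncomputable def shapeCount (D : ℤ) (X : ℝ) : ℕ∞ :=
  countCubicFields fun K => |(NumberField.discr K : ℝ)| < X ∧ HasShapeOfDisc (𝓞 K) D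

/-! In a normalized basis, the multiplication of `R_K` is encoded by a binary cubic form `f` with
`Disc f = Disc K`. The trace form on the trace-zero part of `ℤ + 3R_K` is 6 times the Hessian of
`f`, which has discriminant `-3 Disc K`. So the shape has discriminant `D` exactly when `D k² = -3
Disc K`, where `k` is the content of the Hessian (`hasShapeOfDisc_iff`).

The resolvent is `ℚ(√d)` exactly when `Disc K = d u²`, with `u` integral because `d` is fundamental.
The crux is that `u ∣ k` (`IsIndexForm.dvd_content_hessian`). At a prime `p ∣ u`, maximality of
`R_K` forces a triple root of `f` modulo `p`. The power of `p` in `u` is then at most `p` (at most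
`9` if `p = 3`), and the Hessian is divisible by that much.

Writing `k = u j` gives `-3d = D j²`, and fundamentality of `d` leaves only `j = 1`, or `j = 3` with
`3 ∣ d`: these are the shape discriminants `-3d` and `-d/3`. Conversely, either one makes `Disc K /
d` a rational square. The two cases are disjoint because the shape discriminant is an isomorphism
invariant, and finiteness is Hermite's theorem. -/

/-! ### Arithmetic of fundamental discriminants. -/

/-- Fundamental discriminants are `0` or `1` modulo `4`. -/
theorem IsFundamentalDiscriminant.emod_four {d : ℤ} (hd : IsFundamentalDiscriminant d) :
    d % 4 = 0 ∨ d % 4 = 1 := by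
  rcases hd with ⟨h, -⟩ | ⟨m, rfl, -, -⟩ <;> omega

theorem IsFundamentalDiscriminant.ne_zero {d : ℤ} (hd : IsFundamentalDiscriminant d) : d ≠ 0 := by
  rcases hd with ⟨h, -⟩ | ⟨m, rfl, h, -⟩ <;> omega

theorem Int.sq_emod_four (j : ℤ) : j ^ 2 % 4 = 0 ∨ j ^ 2 % 4 = 1 := by
  rcases Int.even_or_odd' j with ⟨k, rfl | rfl⟩
  · left; ring_nf; omega
  · right; ring_nf; omega

/-- Integers that are `0` or `1` modulo `4` are closed under multiplication. -/
theorem Int.mul_emod_four {x y : ℤ} (hx : x % 4 = 0 ∨ x % 4 = 1) (hy : y % 4 = 0 ∨ y % 4 = 1) :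
    (x * y) % 4 = 0 ∨ (x * y) % 4 = 1 := by
  rw [Int.mul_emod]
  rcases hx with hx | hx <;> rcases hy with hy | hy <;> simp [hx, hy]

/-- The odd square divisors of a fundamental discriminant are trivial. -/
theorem IsFundamentalDiscriminant.not_sq_dvd {d : ℤ} (hd : IsFundamentalDiscriminant d) {p : ℕ}
    (hp : p.Prime) (h2 : p ≠ 2) : ¬ (p : ℤ) ^ 2 ∣ d := by
  have hpi : Prime (p : ℤ) := Nat.prime_iff_prime_int.mp hp
  intro h
  rcases hd with ⟨-, hs⟩ | ⟨m, rfl, -, hs⟩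
  · exact hpi.not_isUnit (hs _ (by simpa [sq] using h))
  · have hc : IsCoprime ((p : ℤ) ^ 2) 4 := by
      have : Nat.Coprime (p ^ 2) (2 ^ 2) :=
        Nat.Coprime.pow _ _ ((Nat.coprime_primes hp Nat.prime_two).2 h2)
      simpa using Nat.isCoprime_iff_coprime.2 this
    exact hpi.not_isUnit (hs _ (by simpa [sq] using hc.dvd_of_dvd_mul_left h))

/-- A fundamental discriminant is not `4` times an integer that is `0` or `1` modulo `4`. -/
theorem IsFundamentalDiscriminant.ne_four_mul {d : ℤ} (hd : IsFundamentalDiscriminant d) {m : ℤ}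
    (hm : m % 4 = 0 ∨ m % 4 = 1) : d ≠ 4 * m := by
  rcases hd with ⟨h, -⟩ | ⟨m', rfl, h, -⟩ <;> omega

/-- If `-3d = D j²` with `d` fundamental and `D` a discriminant, then `j = 1`, or `j = 3` and
`3 ∣ d`. -/
theorem IsFundamentalDiscriminant.eq_one_or_three {d D : ℤ} {j : ℕ}
    (hd : IsFundamentalDiscriminant d) (hD : D % 4 = 0 ∨ D % 4 = 1)
    (h : -3 * d = D * (j : ℤ) ^ 2) : j = 1 ∨ (j = 3 ∧ 3 ∣ d) := by
  have h3 : ∀ p : ℕ, p.Prime → p ∣ j → p = 3 := by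
    rintro p hp ⟨i, rfl⟩
    by_contra hne
    have hc : IsCoprime ((p : ℤ) ^ 2) (-3) := by
      have : Nat.Coprime (p ^ 2) 3 :=
        Nat.Coprime.pow_left _ ((Nat.coprime_primes hp Nat.prime_three).2 hne)
      exact IsCoprime.neg_right (by simpa using Nat.isCoprime_iff_coprime.2 this)
    by_cases h2 : p = 2
    · subst h2
      push_cast at h
      have := Int.mul_emod_four hD (Int.sq_emod_four i)
      -- Since `-3 ≡ 1 (mod 4)`, the residue of `d / 4` is that of `D i²`, hence `0` or `1`.
      have e : -3 * d = 4 * (D * (i : ℤ) ^ 2) := by rw [h]; ring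
      refine hd.ne_four_mul (m := d / 4) ?_ ?_ <;> omega
    · refine hd.not_sq_dvd hp h2 (hc.dvd_of_dvd_mul_left ?_)
      rw [h]
      exact ⟨D * i ^ 2, by push_cast; ring⟩
  have h9 : ¬ 9 ∣ j := by
    rintro ⟨i, rfl⟩
    refine hd.not_sq_dvd Nat.prime_three (by norm_num) ⟨-(3 * (D * (i : ℤ) ^ 2)), ?_⟩
    push_cast at h ⊢
    linarith
  have hj0 : j ≠ 0 := by
    rintro rfl
    have := hd.ne_zero
    simp at h
    omega
  by_cases hj : j = 1
  · exact Or.inl hj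
  obtain ⟨p, hp, hpj⟩ := Nat.exists_prime_and_dvd hj
  obtain rfl := h3 p hp hpj
  obtain ⟨i, rfl⟩ := hpj
  have hi : i = 1 := by
    by_contra hi
    obtain ⟨q, hq, hqi⟩ := Nat.exists_prime_and_dvd hi
    obtain rfl := h3 q hq (hqi.mul_left 3)
    obtain ⟨r, rfl⟩ := hqi
    exact h9 ⟨r, by ring⟩
  subst hi
  refine Or.inr ⟨rfl, ?_⟩
  push_cast at h
  omega

/-- If `Δ v² = d u²` with `d` fundamental and `Δ` a discriminant, then `Δ = d f²`. -/
theorem IsFundamentalDiscriminant.exists_eq_mul_sq {d Δ : ℤ} (hd : IsFundamentalDiscriminant d)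
    (hΔ : Δ % 4 = 0 ∨ Δ % 4 = 1) {q : ℚ} (h : (Δ : ℚ) = d * q ^ 2) :
    ∃ f : ℕ, Δ = d * (f : ℤ) ^ 2 := by
  have hq : Δ * (q.den : ℤ) ^ 2 = d * q.num ^ 2 := by
    have hden : (q.den : ℚ) ≠ 0 := by exact_mod_cast q.den_ne_zero
    have : (Δ : ℚ) * (q.den : ℚ) ^ 2 = d * (q.num : ℚ) ^ 2 := by
      rw [h]
      nth_rewrite 1 [← Rat.num_div_den q]
      field_simp
    exact_mod_cast this
  have hcop : IsCoprime ((q.den : ℤ) ^ 2) (q.num ^ 2) := by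
    refine (IsCoprime.pow ?_)
    rw [Int.isCoprime_iff_gcd_eq_one, Int.gcd_comm]
    exact q.reduced
  have hdvd : (q.den : ℤ) ^ 2 ∣ d := hcop.dvd_of_dvd_mul_right ⟨Δ, by rw [← hq]; ring⟩
  have h2 : ∀ p : ℕ, p.Prime → ¬ p ∣ q.den := by
    intro p hp hpq
    by_cases hp2 : p = 2
    · subst hp2
      obtain ⟨i, hi⟩ := hpq
      obtain ⟨m, hm⟩ := hdvd
      rw [hi] at hm hq
      push_cast at hm hq
      have hi0 : (i : ℤ) ^ 2 ≠ 0 := by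
        have := q.den_ne_zero
        have : i ≠ 0 := by rintro rfl; simp at hi
        positivity
      have hΔm : Δ = m * q.num ^ 2 := by
        have : (4 * (i : ℤ) ^ 2) * Δ = (4 * (i : ℤ) ^ 2) * (m * q.num ^ 2) := by
          rw [hm] at hq; linarith
        exact mul_left_cancel₀ (mul_ne_zero (by norm_num) hi0) this
      have hodd : q.num % 2 = 1 := by
        have h1 : ¬ (2 : ℤ) ∣ q.num := by
          intro h2
          have := q.reduced
          have h2' : 2 ∣ q.num.natAbs := by omega
          have : 2 ∣ Nat.gcd q.num.natAbs q.den := Nat.dvd_gcd h2' ⟨i, hi⟩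
          rw [q.reduced] at this
          omega
        omega
      have hn : q.num ^ 2 % 4 = 1 := by
        obtain ⟨k, hk⟩ : ∃ k, q.num = 2 * k + 1 := ⟨q.num / 2, by omega⟩
        rw [hk]; ring_nf; omega
      -- An even denominator makes the numerator odd, so `m ≡ Δ (mod 4)`; then `d = 4 i² m` is not
      -- fundamental.
      have hm4 : m % 4 = 0 ∨ m % 4 = 1 := by
        rw [hΔm, Int.mul_emod, hn] at hΔ
        simpa using hΔ
      refine hd.ne_four_mul (m := i ^ 2 * m) (Int.mul_emod_four (Int.sq_emod_four _) hm4) ?_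
      rw [hm]; ring
    · refine hd.not_sq_dvd hp hp2 (dvd_trans ?_ hdvd)
      exact pow_dvd_pow_of_dvd (Int.natCast_dvd_natCast.2 hpq) 2
  have h1 : q.den = 1 := by
    by_contra hne
    obtain ⟨p, hp, hpq⟩ := Nat.exists_prime_and_dvd hne
    exact h2 p hp hpq
  refine ⟨q.num.natAbs, ?_⟩
  rw [h1] at hq
  simpa using hq

/-! ### Content and primitive part of binary quadratic forms. -/

namespace BinQuadForm

/-- The greatest common divisor of the coefficients. -/
def content (Q : BinQuadForm) : ℕ := Int.gcd Q.r (Int.gcd Q.s Q.t)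

theorem dvd_content {Q : BinQuadForm} {m : ℤ} :
    m ∣ Q.content ↔ m ∣ Q.r ∧ m ∣ Q.s ∧ m ∣ Q.t := by
  simp only [content, Int.dvd_coe_gcd_iff]

theorem disc_emod_four (Q : BinQuadForm) : Q.disc % 4 = 0 ∨ Q.disc % 4 = 1 := by
  have := Int.sq_emod_four Q.s
  have e : Q.disc = Q.s ^ 2 - 4 * (Q.r * Q.t) := by unfold disc; ring
  omega

theorem disc_mul_sq {Q Q' : BinQuadForm} {k : ℤ} (hr : Q.r = k * Q'.r) (hs : Q.s = k * Q'.s)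
    (ht : Q.t = k * Q'.t) : Q'.disc * k ^ 2 = Q.disc := by
  rw [disc, disc, hr, hs, ht]
  ring

/-- A nonzero form is its content times a primitive form. -/
theorem exists_isPrimitive {Q : BinQuadForm} (hQ : Q.content ≠ 0) : ∃ Q' : BinQuadForm,
    Q'.IsPrimitive ∧ Q.r = Q.content * Q'.r ∧ Q.s = Q.content * Q'.s ∧
      Q.t = Q.content * Q'.t := by
  obtain ⟨⟨r, hr⟩, ⟨s, hs⟩, ⟨t, ht⟩⟩ := dvd_content.1 (dvd_refl (Q.content : ℤ))
  refine ⟨⟨r, s, t⟩, ?_, hr, hs, ht⟩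
  rintro k ⟨r', rfl⟩ ⟨s', rfl⟩ ⟨t', rfl⟩
  have : (Q.content : ℤ) * k ∣ Q.content := by
    rw [dvd_content]
    exact ⟨⟨r', by rw [hr]; ring⟩, ⟨s', by rw [hs]; ring⟩, ⟨t', by rw [ht]; ring⟩⟩
  have h0 : (Q.content : ℤ) ≠ 0 := by exact_mod_cast hQ
  obtain ⟨u, hu⟩ := this
  refine IsUnit.of_mul_eq_one u (mul_left_cancel₀ h0 ?_)
  rw [mul_one, ← mul_assoc, ← hu]

end BinQuadForm

/-! ### Binary cubic forms, Hessians and double roots modulo primes. -/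

/-- An integral binary cubic form `a x³ + b x² y + c x y² + e y³`. -/
@[ext]
structure BinCubicForm where
  a : ℤ
  b : ℤ
  c : ℤ
  e : ℤ

namespace BinCubicForm

/-- The discriminant of a binary cubic form. -/
def disc (f : BinCubicForm) : ℤ :=
  f.b ^ 2 * f.c ^ 2 - 4 * f.a * f.c ^ 3 - 4 * f.b ^ 3 * f.e - 27 * f.a ^ 2 * f.e ^ 2 +
    18 * f.a * f.b * f.c * f.e

/-- The Hessian covariant of a binary cubic form. -/
def hessian (f : BinCubicForm) : BinQuadForm :=
  ⟨f.b ^ 2 - 3 * f.a * f.c, f.b * f.c - 9 * f.a * f.e, f.c ^ 2 - 3 * f.b * f.e⟩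

theorem disc_hessian (f : BinCubicForm) : f.hessian.disc = -3 * f.disc := by
  simp only [BinQuadForm.disc, hessian, disc]; ring

/-- Modulo 4 the discriminant is the square of `bc + ae`. -/
theorem disc_emod_four (f : BinCubicForm) : f.disc % 4 = 0 ∨ f.disc % 4 = 1 := by
  have := Int.sq_emod_four (f.b * f.c + f.a * f.e)
  have e : f.disc = (f.b * f.c + f.a * f.e) ^ 2 + 4 * (-(f.a * f.c ^ 3) - f.b ^ 3 * f.e -
    7 * f.a ^ 2 * f.e ^ 2 + 4 * f.a * f.b * f.c * f.e) := by unfold disc; ring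
  omega

theorem content_hessian_ne_zero {f : BinCubicForm} (hf : f.disc ≠ 0) : f.hessian.content ≠ 0 := by
  intro h
  have h0 : (0 : ℤ) ∣ f.hessian.content := by rw [h]; simp
  rw [BinQuadForm.dvd_content] at h0
  simp only [zero_dvd_iff] at h0
  have := f.disc_hessian
  rw [BinQuadForm.disc, h0.1, h0.2.1] at this
  omega

/-- The form with the variables exchanged (and negated). -/
def swap (f : BinCubicForm) : BinCubicForm := ⟨-f.e, -f.c, -f.b, -f.a⟩

/-- The form `f (x, y + s x)`. -/
def shear (f : BinCubicForm) (s : ℤ) : BinCubicForm :=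
  ⟨f.a + s * f.b + s ^ 2 * f.c + s ^ 3 * f.e, f.b + 2 * s * f.c + 3 * s ^ 2 * f.e,
    f.c + 3 * s * f.e, f.e⟩

/-- The characteristics 2 and 3 are checked exhaustively, since the general root formulas divide by
2 and 3. The alternatives are a double root at `(0, 1)` and one at `(1, s)`. -/
theorem exists_double_root_zmod_two : ∀ a b c e : ZMod 2,
    b ^ 2 * c ^ 2 - 4 * a * c ^ 3 - 4 * b ^ 3 * e - 27 * a ^ 2 * e ^ 2 +
      18 * a * b * c * e = 0 →
    (e = 0 ∧ c = 0) ∨ ∃ s : ZMod 2, a + s * b + s ^ 2 * c + s ^ 3 * e = 0 ∧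
      b + 2 * s * c + 3 * s ^ 2 * e = 0 := by decide

theorem exists_double_root_zmod_three : ∀ a b c e : ZMod 3,
    b ^ 2 * c ^ 2 - 4 * a * c ^ 3 - 4 * b ^ 3 * e - 27 * a ^ 2 * e ^ 2 +
      18 * a * b * c * e = 0 →
    (e = 0 ∧ c = 0) ∨ ∃ s : ZMod 3, a + s * b + s ^ 2 * c + s ^ 3 * e = 0 ∧
      b + 2 * s * c + 3 * s ^ 2 * e = 0 := by decide

/-- A binary cubic form of discriminant zero over `𝔽_p` has a rational double root. -/
theorem exists_double_root_zmod {p : ℕ} [hp : Fact p.Prime] (a b c e : ZMod p)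
    (h : b ^ 2 * c ^ 2 - 4 * a * c ^ 3 - 4 * b ^ 3 * e - 27 * a ^ 2 * e ^ 2 +
      18 * a * b * c * e = 0) :
    (e = 0 ∧ c = 0) ∨ ∃ s : ZMod p, a + s * b + s ^ 2 * c + s ^ 3 * e = 0 ∧
      b + 2 * s * c + 3 * s ^ 2 * e = 0 := by
  by_cases hp2 : p = 2
  · subst hp2; exact exists_double_root_zmod_two a b c e h
  by_cases hp3 : p = 3
  · subst hp3; exact exists_double_root_zmod_three a b c e h
  have h2 : (2 : ZMod p) ≠ 0 := by
    intro h0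
    have : ((2 : ℕ) : ZMod p) = 0 := by exact_mod_cast h0
    rw [ZMod.natCast_eq_zero_iff, Nat.prime_dvd_prime_iff_eq hp.out Nat.prime_two] at this
    exact hp2 this
  have h3 : (3 : ZMod p) ≠ 0 := by
    intro h0
    have : ((3 : ℕ) : ZMod p) = 0 := by exact_mod_cast h0
    rw [ZMod.natCast_eq_zero_iff, Nat.prime_dvd_prime_iff_eq hp.out Nat.prime_three] at this
    exact hp3 this
  -- The Hessian has discriminant `-3 disc = 0`. If its last coefficient vanishes, so does the
  -- middle one, and for `e ≠ 0` the root is the triple root `-c / (3e)`.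
  by_cases hR : c ^ 2 - 3 * b * e = 0
  · have hQ : b * c - 9 * a * e = 0 := by
      have : (b * c - 9 * a * e) ^ 2 = 0 := by
        linear_combination (-3) * h + 4 * (b ^ 2 - 3 * a * c) * hR
      simpa using this
    by_cases he : e = 0
    · left
      subst he
      simpa using hR
    · right
      refine ⟨-c / (3 * e), ?_, ?_⟩
      · field_simp
        linear_combination (2 * c) * hR + (-3 * e) * hQ
      · field_simp
        linear_combination (-1) * hR
  · right
    have hR2 : 2 * (c ^ 2 - 3 * b * e) ≠ 0 := mul_ne_zero h2 hR
    -- The double root of the cubic is the double root of its Hessian, read off from the last two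
    -- Hessian coefficients.
    obtain ⟨s, hs⟩ : ∃ s, 2 * (c ^ 2 - 3 * b * e) * s = 9 * a * e - b * c :=
      ⟨_, mul_div_cancel₀ _ hR2⟩
    set R := c ^ 2 - 3 * b * e with hRdef
    set N := 9 * a * e - b * c with hNdef
    refine ⟨s, mul_left_cancel₀ (pow_ne_zero 3 hR2) ?_, mul_left_cancel₀ (pow_ne_zero 2 hR2) ?_⟩
    · have : 8 * R ^ 3 * a + 4 * R ^ 2 * N * b + 2 * R * N ^ 2 * c + N ^ 3 * e = 0 := by
        rw [hRdef, hNdef]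
        linear_combination (-2 * c * (c ^ 2 - 3 * b * e) - 3 * e * (9 * a * e - b * c)) * h
      linear_combination this + (4 * R ^ 2 * b + 2 * R * c * (2 * R * s + N) +
        e * ((2 * R * s) ^ 2 + 2 * R * s * N + N ^ 2)) * hs
    · have : 4 * R ^ 2 * b + 4 * R * N * c + 3 * N ^ 2 * e = 0 := by
        rw [hRdef, hNdef]
        linear_combination (-9 * e) * h
      linear_combination this + (4 * R * c + 3 * e * (2 * R * s + N)) * hs

/-- A binary cubic form of discriminant divisible by `p` has a double root modulo `p`. -/
theorem exists_double_root {p : ℕ} (hp : p.Prime) {f : BinCubicForm} (h : (p : ℤ) ∣ f.disc) :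
    ((p : ℤ) ∣ f.e ∧ (p : ℤ) ∣ f.c) ∨ ∃ s : ℤ, (p : ℤ) ∣ (f.shear s).a ∧ (p : ℤ) ∣ (f.shear s).b := by
  have := Fact.mk hp
  rw [← ZMod.intCast_zmod_eq_zero_iff_dvd] at h
  simp only [← ZMod.intCast_zmod_eq_zero_iff_dvd]
  simp only [disc] at h
  push_cast at h
  obtain h | ⟨s, h⟩ := exists_double_root_zmod _ _ _ _ h
  · exact Or.inl h
  · obtain ⟨t, rfl⟩ := ZMod.intCast_surjective s
    refine Or.inr ⟨t, ?_⟩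
    simp only [shear]
    push_cast
    exact h

/-! ### Local bounds at a totally ramified prime. -/

section Local

variable {f : BinCubicForm} {p : ℕ} {d u : ℤ}

/-- If `p²` does not divide `a`, then a form of discriminant `d u²` with `p ∣ u` and a double root modulo `p`
at `(1, 0)` has a triple root there. -/
theorem dvd_c_of_dvd_sqrt (hp : p.Prime) (hd : d % 4 = 0 ∨ d % 4 = 1) (ha : (p : ℤ) ∣ f.a)
    (hb : (p : ℤ) ∣ f.b) (ha2 : ¬ (p : ℤ) ^ 2 ∣ f.a) (hf : f.disc = d * u ^ 2) (hu : (p : ℤ) ∣ u) :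
    (p : ℤ) ∣ f.c := by
  have hpi : Prime (p : ℤ) := Nat.prime_iff_prime_int.mp hp
  have hp0 : (p : ℤ) ≠ 0 := hpi.ne_zero
  obtain ⟨a, b, c, e⟩ := f
  obtain ⟨a, rfl⟩ := ha
  obtain ⟨b, rfl⟩ := hb
  obtain ⟨u, rfl⟩ := hu
  simp only [disc] at *
  have hpa : ¬ (p : ℤ) ∣ a := by
    rintro ⟨i, rfl⟩
    exact ha2 ⟨i, by ring⟩
  -- Every other term of the discriminant, and `d u²` itself, is divisible by `p²`.
  have h1 : (p : ℤ) ∣ 4 * (a * c ^ 3) := by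
    refine ⟨b ^ 2 * c ^ 2 - 4 * p * b ^ 3 * e - 27 * a ^ 2 * e ^ 2 + 18 * a * b * c * e -
      d * u ^ 2, mul_left_cancel₀ hp0 ?_⟩
    linear_combination -hf
  by_contra hc
  by_cases hp2 : p = 2
  -- The factor 4 makes `h1` empty here. If `c` were odd, a quarter of the discriminant would be `(b
  -- + e)² - 2 (mod 4)`, that is `2` or `3`, while `d u²` is `0` or `1`.
  · subst hp2
    push_cast at *
    have h2 : b ^ 2 * c ^ 2 - 2 * a * c ^ 3 - 8 * b ^ 3 * e + 18 * a * b * c * e -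
        27 * a ^ 2 * e ^ 2 = d * u ^ 2 := by linarith
    have h3 := Int.mul_emod_four hd (Int.sq_emod_four u)
    rw [← h2] at h3
    obtain ⟨a', rfl⟩ : ∃ k, a = 2 * k + 1 := ⟨a / 2, by omega⟩
    obtain ⟨c', rfl⟩ : ∃ k, c = 2 * k + 1 := ⟨c / 2, by omega⟩
    have h4 := Int.sq_emod_four (b + e)
    have : b ^ 2 * (2 * c' + 1) ^ 2 - 2 * (2 * a' + 1) * (2 * c' + 1) ^ 3 - 8 * b ^ 3 * e +
        18 * (2 * a' + 1) * b * (2 * c' + 1) * e - 27 * (2 * a' + 1) ^ 2 * e ^ 2 =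
        (b + e) ^ 2 - 2 + 4 * (b ^ 2 * (c' ^ 2 + c') - a' * (2 * c' + 1) ^ 3 -
          (4 * c' ^ 3 + 6 * c' ^ 2 + 3 * c') - 2 * b ^ 3 * e +
          (18 * a' * c' + 9 * a' + 9 * c' + 4) * b * e - (27 * (a' ^ 2 + a') + 7) * e ^ 2) := by
      ring
    omega
  · obtain h4 | h4 := hpi.dvd_or_dvd h1
    · have : p ∣ 2 ^ 2 := by exact_mod_cast h4
      exact hp2 ((Nat.prime_dvd_prime_iff_eq hp Nat.prime_two).1 (hp.dvd_of_dvd_pow this))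
    · obtain h5 | h5 := hpi.dvd_or_dvd h4
      · exact hpa h5
      · exact hc (hpi.dvd_of_dvd_pow h5)

/-- A form with a totally ramified root at `(1, 0)` has discriminant exactly divisible by `p²`, for
`p ≠ 3`. -/
theorem not_sq_dvd_sqrt (hp : p.Prime) (hp3 : p ≠ 3) (ha : (p : ℤ) ∣ f.a) (hb : (p : ℤ) ∣ f.b)
    (hc : (p : ℤ) ∣ f.c) (he : ¬ (p : ℤ) ∣ f.e) (ha2 : ¬ (p : ℤ) ^ 2 ∣ f.a)
    (hf : f.disc = d * u ^ 2) : ¬ (p : ℤ) ^ 2 ∣ u := by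
  have hpi : Prime (p : ℤ) := Nat.prime_iff_prime_int.mp hp
  have hp0 : (p : ℤ) ≠ 0 := hpi.ne_zero
  rintro ⟨u, rfl⟩
  obtain ⟨a, b, c, e⟩ := f
  obtain ⟨a, rfl⟩ := ha
  obtain ⟨b, rfl⟩ := hb
  obtain ⟨c, rfl⟩ := hc
  simp only [disc] at *
  have hpa : ¬ (p : ℤ) ∣ a := by
    rintro ⟨i, rfl⟩
    exact ha2 ⟨i, by ring⟩
  have h1 : (p : ℤ) ∣ 27 * (a ^ 2 * e ^ 2) := by
    refine ⟨p * b ^ 2 * c ^ 2 - 4 * p * a * c ^ 3 - 4 * b ^ 3 * e + 18 * a * b * c * e -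
      d * p * u ^ 2, mul_left_cancel₀ (pow_ne_zero 2 hp0) ?_⟩
    linear_combination -hf
  obtain h4 | h4 := hpi.dvd_or_dvd h1
  · have : p ∣ 3 ^ 3 := by exact_mod_cast h4
    exact hp3 ((Nat.prime_dvd_prime_iff_eq hp Nat.prime_three).1 (hp.dvd_of_dvd_pow this))
  · obtain h5 | h5 := hpi.dvd_or_dvd h4
    · exact hpa (hpi.dvd_of_dvd_pow h5)
    · exact he (hpi.dvd_of_dvd_pow h5)

/-- A form with a totally ramified root at `(1, 0)` modulo `3` has discriminant not divisible by
`3⁶`. -/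
theorem not_twentySeven_dvd_sqrt (ha : 3 ∣ f.a) (hb : 3 ∣ f.b)
    (hc : 3 ∣ f.c) (he : ¬ 3 ∣ f.e) (ha2 : ¬ 3 ^ 2 ∣ f.a) (hf : f.disc = d * u ^ 2) :
    ¬ 3 ^ 3 ∣ u := by
  have hpi : Prime (3 : ℤ) := Int.prime_three
  rintro ⟨u, rfl⟩
  obtain ⟨a, b, c, e⟩ := f
  obtain ⟨a, rfl⟩ := ha
  obtain ⟨b, rfl⟩ := hb
  obtain ⟨c, rfl⟩ := hc
  simp only [disc] at *
  -- Dividing by 27 and reading modulo 3, 9 and 27 in turn forces `3 ∣ b`, `3 ∣ c` and finally `3 ∣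
  -- a² e²`.
  have h1 : 3 * b ^ 2 * c ^ 2 - 12 * a * c ^ 3 - 4 * b ^ 3 * e - 9 * a ^ 2 * e ^ 2 +
      18 * a * b * c * e = 27 * (d * u ^ 2) := by linarith
  have hpa : ¬ 3 ∣ a := by
    rintro ⟨i, rfl⟩
    exact ha2 ⟨i, by ring⟩
  have hb3 : 3 ∣ b := by
    have : 3 ∣ 4 * (b ^ 3 * e) := ⟨b ^ 2 * c ^ 2 - 4 * a * c ^ 3 - 3 * a ^ 2 * e ^ 2 +
      6 * a * b * c * e - 9 * (d * u ^ 2), by linarith⟩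
    obtain h | h := hpi.dvd_or_dvd this
    · norm_num at h
    · exact hpi.dvd_of_dvd_pow ((hpi.dvd_or_dvd h).resolve_right he)
  obtain ⟨b, rfl⟩ := hb3
  have hc3 : 3 ∣ c := by
    have : 3 ∣ 4 * (a * c ^ 3) := ⟨3 * b ^ 2 * c ^ 2 - 12 * b ^ 3 * e - a ^ 2 * e ^ 2 +
      6 * a * b * c * e - 3 * (d * u ^ 2), by linarith⟩
    obtain h | h := hpi.dvd_or_dvd this
    · norm_num at h
    · exact hpi.dvd_of_dvd_pow ((hpi.dvd_or_dvd h).resolve_left hpa)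
  obtain ⟨c, rfl⟩ := hc3
  have : 3 ∣ a ^ 2 * e ^ 2 := ⟨9 * b ^ 2 * c ^ 2 - 12 * a * c ^ 3 - 4 * b ^ 3 * e +
    6 * a * b * c * e - d * u ^ 2, by linarith⟩
  obtain h | h := hpi.dvd_or_dvd this
  · exact hpa (hpi.dvd_of_dvd_pow h)
  · exact he (hpi.dvd_of_dvd_pow h)

end Local

/-- Modulo a prime of total ramification, the Hessian vanishes. -/
theorem dvd_content_hessian {f : BinCubicForm} {p : ℤ} (ha : p ∣ f.a) (hb : p ∣ f.b)
    (hc : p ∣ f.c) : p ∣ f.hessian.content := by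
  obtain ⟨a, b, c, e⟩ := f
  obtain ⟨a, rfl⟩ := ha
  obtain ⟨b, rfl⟩ := hb
  obtain ⟨c, rfl⟩ := hc
  rw [BinQuadForm.dvd_content]
  exact ⟨⟨p * b ^ 2 - 3 * p * a * c, by simp only [hessian]; ring⟩,
    ⟨p * b * c - 9 * a * e, by simp only [hessian]; ring⟩,
    ⟨p * c ^ 2 - 3 * b * e, by simp only [hessian]; ring⟩⟩

/-- The constants 3 and 9 in the Hessian supply the extra factor at `p = 3`, matching the weaker
bound on the power of 3 in `u`. -/
theorem nine_dvd_content_hessian {f : BinCubicForm} (ha : 3 ∣ f.a) (hb : 3 ∣ f.b)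
    (hc : 3 ∣ f.c) : 9 ∣ (f.hessian.content : ℤ) := by
  obtain ⟨a, b, c, e⟩ := f
  obtain ⟨a, rfl⟩ := ha
  obtain ⟨b, rfl⟩ := hb
  obtain ⟨c, rfl⟩ := hc
  rw [BinQuadForm.dvd_content]
  exact ⟨⟨b ^ 2 - 3 * a * c, by simp only [hessian]; ring⟩,
    ⟨b * c - 3 * a * e, by simp only [hessian]; ring⟩,
    ⟨c ^ 2 - b * e, by simp only [hessian]; ring⟩⟩

end BinCubicForm

/-! ### The Delone–Faddeev correspondence and the trace form. -/

section CubicRing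

variable {R : Type*} [CommRing R]

theorem Module.Basis.exists_coords (B : Module.Basis (Fin 3) ℤ R) (h0 : B 0 = 1) (z : R) :
    ∃ x y w : ℤ, z = x + y * B 1 + w * B 2 := by
  refine ⟨B.repr z 0, B.repr z 1, B.repr z 2, ?_⟩
  have := B.sum_repr z
  rw [Fin.sum_univ_three, h0] at this
  simp only [zsmul_eq_mul, mul_one] at this
  exact this.symm

theorem Module.Basis.repr_coords (B : Module.Basis (Fin 3) ℤ R) (h0 : B 0 = 1) (x y w : ℤ) :
    B.repr (x + y * B 1 + w * B 2) =
      Finsupp.single 0 x + Finsupp.single 1 y + Finsupp.single 2 w := by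
  have : (x + y * B 1 + w * B 2 : R) = x • B 0 + y • B 1 + w • B 2 := by
    rw [h0]; simp only [zsmul_eq_mul, mul_one]
  rw [this]
  simp only [map_add, map_smul, Module.Basis.repr_self, Finsupp.smul_single, smul_eq_mul, mul_one]

theorem Module.Basis.coords_eq_zero (B : Module.Basis (Fin 3) ℤ R) (h0 : B 0 = 1) {x y w : ℤ}
    (h : (x + y * B 1 + w * B 2 : R) = 0) : x = 0 ∧ y = 0 ∧ w = 0 := by
  have := B.repr_coords h0 x y w
  rw [h, map_zero] at this
  refine ⟨?_, ?_, ?_⟩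
  · simpa using (DFunLike.congr_fun this 0).symm
  · simpa using (DFunLike.congr_fun this 1).symm
  · simpa using (DFunLike.congr_fun this 2).symm

/-- A change of basis fixing `1`. -/
theorem Module.Basis.exists_of_det (B : Module.Basis (Fin 3) ℤ R) (h0 : B 0 = 1)
    {n p q m r s : ℤ} (h : IsUnit (p * s - q * r)) :
    ∃ B' : Module.Basis (Fin 3) ℤ R, B' 0 = 1 ∧ B' 1 = n + p * B 1 + q * B 2 ∧
      B' 2 = m + r * B 1 + s * B 2 := by
  have hu : IsUnit (B.det ![1, n + p * B 1 + q * B 2, m + r * B 1 + s * B 2]) := by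
    rw [Module.Basis.det_apply, Matrix.det_fin_three]
    have h1 : B.repr 1 = Finsupp.single 0 1 := by rw [← h0, B.repr_self]
    simp [Module.Basis.toMatrix_apply, h1, B.repr_coords h0]
    convert h using 1
    ring
  rw [← Module.Basis.is_basis_iff_det] at hu
  refine ⟨Module.Basis.mk hu.1 hu.2.ge, ?_, ?_, ?_⟩ <;> simp [Module.Basis.mk_apply]

/-- `f` is the index form of the cubic ring `R` in the basis `1, B 1, B 2`: the multiplication is
given by the Delone–Faddeev table of `f`. -/
structure IsIndexBasis (B : Module.Basis (Fin 3) ℤ R) (f : BinCubicForm) : Prop where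
  zero : B 0 = 1
  mul : B 1 * B 2 = -(f.a * f.e)
  sq_one : B 1 ^ 2 = -(f.a * f.c) + f.b * B 1 - f.a * B 2
  sq_two : B 2 ^ 2 = -(f.b * f.e) + f.e * B 1 - f.c * B 2

/-- `f` is an index form of `R`. -/
def IsIndexForm (R : Type*) [CommRing R] (f : BinCubicForm) : Prop :=
  ∃ B : Module.Basis (Fin 3) ℤ R, IsIndexBasis B f

/-- Every basis of a cubic ring starting with `1` can be normalized. -/
theorem exists_isIndexForm (B : Module.Basis (Fin 3) ℤ R) (h0 : B 0 = 1) :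
    ∃ f, IsIndexForm R f := by
  obtain ⟨n, m₁, m₂, h⟩ := B.exists_coords h0 (B 1 * B 2)
  -- Integer translations remove the linear part of the product of the two basis elements.
  obtain ⟨C, hC0, hC1, hC2⟩ := B.exists_of_det h0 (n := -m₂) (p := 1) (q := 0) (m := -m₁) (r := 0)
    (s := 1) (by norm_num)
  push_cast at hC1 hC2
  have hmul : C 1 * C 2 = ((n + m₁ * m₂ : ℤ) : R) := by
    rw [hC1, hC2]
    push_cast
    linear_combination h
  generalize n + m₁ * m₂ = N at hmul
  obtain ⟨p, q, r, h1⟩ := C.exists_coords hC0 (C 1 ^ 2)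
  obtain ⟨u, v, w, h2⟩ := C.exists_coords hC0 (C 2 ^ 2)
  -- Associativity, `C₁² C₂ = C₁ (C₁ C₂)` and then its mirror image, determines the constant terms
  -- of the table.
  obtain ⟨-, e2, e3⟩ := C.coords_eq_zero hC0 (x := q * N + r * u) (y := r * v - N)
    (w := p + r * w) (by push_cast; linear_combination (C 1 - q) * hmul - C 2 * h1 - r * h2)
  obtain ⟨-, e5, -⟩ := C.coords_eq_zero hC0 (x := v * p + w * N) (y := u + v * q)
    (w := v * r - N) (by push_cast; linear_combination (C 2 - w) * hmul - C 1 * h2 - v * h1)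
  refine ⟨⟨-r, q, -w, v⟩, C, hC0, ?_, ?_, ?_⟩
  · rw [hmul, show N = r * v by linarith]; push_cast; ring
  · rw [h1, show p = -(r * w) by linarith]; push_cast; ring
  · rw [h2, show u = -(v * q) by linarith]; push_cast; ring

theorem IsIndexForm.swap {f : BinCubicForm} (hf : IsIndexForm R f) : IsIndexForm R f.swap := by
  obtain ⟨B, hB⟩ := hf
  obtain ⟨C, hC0, hC1, hC2⟩ := B.exists_of_det hB.zero (n := 0) (p := 0) (q := 1) (m := 0) (r := 1)
    (s := 0) (by norm_num)
  push_cast at hC1 hC2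
  refine ⟨C, hC0, ?_, ?_, ?_⟩ <;> rw [hC1, hC2] <;> simp only [BinCubicForm.swap] <;> push_cast
  · linear_combination hB.mul
  · linear_combination hB.sq_two
  · linear_combination hB.sq_one

/-- With `swap`, this moves a double root modulo `p` to `(1, 0)`. The basis is `ω + sθ, θ`,
translated by integers so that the product is again an integer. -/
theorem IsIndexForm.shear {f : BinCubicForm} (hf : IsIndexForm R f) (s : ℤ) :
    IsIndexForm R (f.shear s) := by
  obtain ⟨B, hB⟩ := hf
  obtain ⟨C, hC0, hC1, hC2⟩ := B.exists_of_det hB.zero (n := s * f.c + s ^ 2 * f.e) (p := 1)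
    (q := s) (m := -(s * f.e)) (r := 0) (s := 1) (by norm_num)
  push_cast at hC1 hC2
  refine ⟨C, hC0, ?_, ?_, ?_⟩ <;> rw [hC1, hC2] <;> simp only [BinCubicForm.shear] <;> push_cast
  · linear_combination hB.mul + s * hB.sq_two
  · linear_combination hB.sq_one + 2 * s * hB.mul + s ^ 2 * hB.sq_two
  · linear_combination hB.sq_two

theorem IsIndexForm.of_ringEquiv {S : Type*} [CommRing S] (φ : R ≃+* S) {f : BinCubicForm}
    (hf : IsIndexForm R f) : IsIndexForm S f := by
  obtain ⟨B, hB⟩ := hf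
  refine ⟨B.map φ.toAddEquiv.toIntLinearEquiv, ?_, ?_, ?_, ?_⟩ <;>
    simp only [Module.Basis.map_apply, AddEquiv.coe_toIntLinearEquiv, RingEquiv.toAddEquiv_eq_coe,
      RingEquiv.coe_toAddEquiv]
  · rw [hB.zero, map_one]
  · rw [← map_mul, hB.mul]; simp
  · rw [← map_pow, hB.sq_one]; simp
  · rw [← map_pow, hB.sq_two]; simp

namespace IsIndexBasis

variable {B : Module.Basis (Fin 3) ℤ R} {f : BinCubicForm}

theorem trace_one (hB : IsIndexBasis B f) : Algebra.trace ℤ R (B 1) = f.b := by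
  rw [Algebra.trace_eq_matrix_trace B, Matrix.trace_fin_three]
  simp only [Algebra.leftMulMatrix_eq_repr_mul]
  have h0 : B 1 * B 0 = (0 : ℤ) + (1 : ℤ) * B 1 + (0 : ℤ) * B 2 := by rw [hB.zero]; simp
  have h1 : B 1 * B 1 = (-(f.a * f.c) : ℤ) + f.b * B 1 + (-f.a : ℤ) * B 2 := by
    push_cast; linear_combination hB.sq_one
  have h2 : B 1 * B 2 = (-(f.a * f.e) : ℤ) + (0 : ℤ) * B 1 + (0 : ℤ) * B 2 := by
    push_cast; linear_combination hB.mul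
  rw [h0, h1, h2]
  simp [B.repr_coords hB.zero, -Int.cast_neg, -Int.cast_mul, -Int.cast_zero, -Int.cast_one]

theorem trace_two (hB : IsIndexBasis B f) : Algebra.trace ℤ R (B 2) = -f.c := by
  rw [Algebra.trace_eq_matrix_trace B, Matrix.trace_fin_three]
  simp only [Algebra.leftMulMatrix_eq_repr_mul]
  have h0 : B 2 * B 0 = (0 : ℤ) + (0 : ℤ) * B 1 + (1 : ℤ) * B 2 := by rw [hB.zero]; simp
  have h1 : B 2 * B 1 = (-(f.a * f.e) : ℤ) + (0 : ℤ) * B 1 + (0 : ℤ) * B 2 := by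
    push_cast; linear_combination hB.mul
  have h2 : B 2 * B 2 = (-(f.b * f.e) : ℤ) + f.e * B 1 + (-f.c : ℤ) * B 2 := by
    push_cast; linear_combination hB.sq_two
  rw [h0, h1, h2]
  simp [B.repr_coords hB.zero, -Int.cast_neg, -Int.cast_mul, -Int.cast_zero, -Int.cast_one]

theorem trace_coords (hB : IsIndexBasis B f) (x y w : ℤ) :
    Algebra.trace ℤ R (x + y * B 1 + w * B 2) = 3 * x + f.b * y - f.c * w := by
  have h1 : Algebra.trace ℤ R 1 = 3 := by
    have := Algebra.trace_algebraMap_of_basis B (1 : ℤ)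
    simpa using this
  have : (x + y * B 1 + w * B 2 : R) = x • 1 + y • B 1 + w • B 2 := by simp
  rw [this, map_add, map_add, map_smul, map_smul, map_smul, h1, hB.trace_one, hB.trace_two]
  simp only [smul_eq_mul]
  ring

theorem discr_eq (hB : IsIndexBasis B f) : Algebra.discr ℤ B = f.disc := by
  have key : ∀ {z : R} {x y w : ℤ}, z = x + y * B 1 + w * B 2 →
      Algebra.trace ℤ R z = 3 * x + f.b * y - f.c * w := by
    rintro z x y w rfl
    exact hB.trace_coords x y w
  have h00 := key (z := B 0 * B 0) (x := 1) (y := 0) (w := 0) (by rw [hB.zero]; simp)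
  have h01 := key (z := B 0 * B 1) (x := 0) (y := 1) (w := 0) (by rw [hB.zero]; simp)
  have h02 := key (z := B 0 * B 2) (x := 0) (y := 0) (w := 1) (by rw [hB.zero]; simp)
  have h11 := key (z := B 1 * B 1) (x := -(f.a * f.c)) (y := f.b) (w := -f.a)
    (by push_cast; linear_combination hB.sq_one)
  have h12 := key (z := B 1 * B 2) (x := -(f.a * f.e)) (y := 0) (w := 0)
    (by push_cast; linear_combination hB.mul)
  have h22 := key (z := B 2 * B 2) (x := -(f.b * f.e)) (y := f.e) (w := -f.c)
    (by push_cast; linear_combination hB.sq_two)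
  rw [Algebra.discr_def, Matrix.det_fin_three]
  simp only [Algebra.traceMatrix_apply, Algebra.traceForm_apply]
  rw [mul_comm (B 1) (B 0), mul_comm (B 2) (B 0), mul_comm (B 2) (B 1), h00, h01, h02, h11, h12,
    h22, BinCubicForm.disc]
  ring

/-- The trace form on the trace-zero part of `ℤ + 3R` is `6` times the Hessian. -/
theorem trace_sq (hB : IsIndexBasis B f) (x y : ℤ) :
    Algebra.trace ℤ R ((x • (3 * B 1 - f.b) + y • (3 * B 2 + f.c)) ^ 2) =
      6 * f.hessian.eval x y := by
  have : ((x • (3 * B 1 - f.b) + y • (3 * B 2 + f.c)) ^ 2 : R) =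
      ((x ^ 2 * (f.b ^ 2 - 9 * (f.a * f.c)) + y ^ 2 * (f.c ^ 2 - 9 * (f.b * f.e)) +
        x * y * (-18 * (f.a * f.e) - 2 * f.b * f.c) : ℤ) : R) +
      ((3 * x ^ 2 * f.b + 9 * y ^ 2 * f.e + 6 * x * y * f.c : ℤ) : R) * B 1 +
      ((-9 * x ^ 2 * f.a - 3 * y ^ 2 * f.c - 6 * x * y * f.b : ℤ) : R) * B 2 := by
    simp only [zsmul_eq_mul]
    push_cast
    linear_combination 9 * x ^ 2 * hB.sq_one + 9 * y ^ 2 * hB.sq_two + 18 * x * y * hB.mul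
  rw [this, hB.trace_coords]
  simp only [BinQuadForm.eval, BinCubicForm.hessian]
  ring

/-- The basis `3ω - Tr ω, 3θ - Tr θ` of the trace-zero part of `ℤ + 3R`. -/
theorem exists_basis_traceZeroLattice (hB : IsIndexBasis B f) :
    ∃ v : Module.Basis (Fin 2) ℤ (traceZeroLattice R),
      (v 0 : R) = 3 * B 1 - f.b ∧ (v 1 : R) = 3 * B 2 + f.c := by
  have mem1 : 3 * B 1 - (f.b : R) ∈ traceZeroLattice R := by
    refine ⟨?_, Submodule.mem_sup.2 ⟨-f.b • 1, ?_, 3 * B 1, ⟨B 1, by simp⟩, by simp; ring⟩⟩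
    · have := hB.trace_coords (-f.b) 3 0
      rw [SetLike.mem_coe, LinearMap.mem_ker]
      convert this using 2 <;> push_cast <;> ring
    · exact Submodule.smul_mem _ _ (Submodule.mem_span_singleton_self _)
  have mem2 : 3 * B 2 + (f.c : R) ∈ traceZeroLattice R := by
    refine ⟨?_, Submodule.mem_sup.2 ⟨f.c • 1, ?_, 3 * B 2, ⟨B 2, by simp⟩, by simp; ring⟩⟩
    · have := hB.trace_coords f.c 0 3
      rw [SetLike.mem_coe, LinearMap.mem_ker]
      convert this using 2 <;> push_cast <;> ring
    · exact Submodule.smul_mem _ _ (Submodule.mem_span_singleton_self _)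
  have li : LinearIndependent ℤ ![(⟨_, mem1⟩ : traceZeroLattice R), ⟨_, mem2⟩] := by
    rw [LinearIndependent.pair_iff]
    intro s t h
    have h' := congrArg Subtype.val h
    simp only [Submodule.coe_add, Submodule.coe_smul, Submodule.coe_zero, zsmul_eq_mul] at h'
    obtain ⟨-, h2, h3⟩ := B.coords_eq_zero hB.zero (x := -s * f.b + t * f.c) (y := 3 * s)
      (w := 3 * t) (by push_cast; linear_combination h')
    omega
  have sp : ⊤ ≤ Submodule.span ℤ
      (Set.range ![(⟨_, mem1⟩ : traceZeroLattice R), ⟨_, mem2⟩]) := by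
    rintro ⟨z, hz⟩ -
    -- Membership in `ℤ + 3R` makes the last two coordinates multiples of 3; trace zero then
    -- determines the first.
    obtain ⟨x, y, w, rfl⟩ : ∃ x y w : ℤ, z = x + 3 * y * B 1 + 3 * w * B 2 := by
      obtain ⟨n, hn, m, ⟨α, rfl⟩, rfl⟩ := Submodule.mem_sup.1 hz.2
      obtain ⟨k, rfl⟩ := Submodule.mem_span_singleton.1 hn
      obtain ⟨x, y, w, rfl⟩ := B.exists_coords hB.zero α
      refine ⟨k + 3 * x, y, w, ?_⟩
      simp
      ring
    have htr : 3 * x + f.b * (3 * y) - f.c * (3 * w) = 0 := by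
      have h := hB.trace_coords x (3 * y) (3 * w)
      push_cast at h
      rw [← h]
      exact hz.1
    rw [Matrix.range_cons, Matrix.range_cons, Matrix.range_empty, Set.union_empty,
      Set.singleton_union, Submodule.mem_span_pair]
    refine ⟨y, w, Subtype.ext ?_⟩
    simp only [Submodule.coe_add, Submodule.coe_smul, zsmul_eq_mul]
    rw [show x = f.c * w - f.b * y by linarith]
    push_cast
    ring
  exact ⟨Module.Basis.mk li sp, by rw [Module.Basis.mk_apply]; rfl,
    by rw [Module.Basis.mk_apply]; rfl⟩

end IsIndexBasis

end CubicRing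

/-- The discriminant scales by the square of the multiplier and of the substitution determinant;
values at `(1,0)`, `(0,1)`, `(1,1)` recover the coefficients. -/
theorem BinQuadForm.disc_of_eval_eq {Q Q' : BinQuadForm} {n n' p q r s : ℤ}
    (h : ∀ x y : ℤ, n' * Q'.eval x y = n * Q.eval (x * p + y * r) (x * q + y * s)) :
    n' ^ 2 * Q'.disc = n ^ 2 * Q.disc * (p * s - q * r) ^ 2 := by
  have h1 := h 1 0
  have h2 := h 0 1
  have h3 := h 1 1
  simp only [BinQuadForm.eval] at h1 h2 h3
  have hr : n' * Q'.r = n * (Q.r * p ^ 2 + Q.s * (p * q) + Q.t * q ^ 2) := by linarith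
  have ht : n' * Q'.t = n * (Q.r * r ^ 2 + Q.s * (r * s) + Q.t * s ^ 2) := by linarith
  have hs : n' * Q'.s = n * (2 * Q.r * p * r + Q.s * (p * s + q * r) + 2 * Q.t * q * s) := by
    linarith
  have : n' ^ 2 * Q'.disc = (n' * Q'.s) ^ 2 - 4 * (n' * Q'.r) * (n' * Q'.t) := by
    unfold BinQuadForm.disc; ring
  rw [this, hr, ht, hs]
  unfold BinQuadForm.disc
  ring

/-- The transition matrix between two bases of a rank two lattice is invertible. -/
theorem Module.Basis.exists_transition {M : Type*} [AddCommGroup M]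
    (v v' : Module.Basis (Fin 2) ℤ M) :
    ∃ p q r s : ℤ, v' 0 = p • v 0 + q • v 1 ∧ v' 1 = r • v 0 + s • v 1 ∧
      (p * s - q * r) ^ 2 = 1 := by
  refine ⟨v.repr (v' 0) 0, v.repr (v' 0) 1, v.repr (v' 1) 0, v.repr (v' 1) 1, ?_, ?_, ?_⟩
  · have := v.sum_repr (v' 0)
    rw [Fin.sum_univ_two] at this
    exact this.symm
  · have := v.sum_repr (v' 1)
    rw [Fin.sum_univ_two] at this
    exact this.symm
  · have h := v.isUnit_det v'
    rw [Module.Basis.det_apply, Matrix.det_fin_two] at h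
    simp only [Module.Basis.toMatrix_apply] at h
    have h1 := Int.isUnit_sq h
    linarith

/-! ### The discriminant of the shape. -/

section Shape

variable {R : Type*} [CommRing R]

/-- The multiplier of the trace form is determined by the values of the form. -/
theorem dvd_multiplier_iff {v : Module.Basis (Fin 2) ℤ (traceZeroLattice R)} {n : ℤ}
    {Q : BinQuadForm} (hQ : Q.IsPrimitive) (h : ∀ x y : ℤ,
      Algebra.trace ℤ R ((x • (v 0 : R) + y • (v 1 : R)) ^ 2) = n * Q.eval x y) (m : ℤ) :
    m ∣ n ↔ ∀ z : traceZeroLattice R, m ∣ Algebra.trace ℤ R ((z : R) ^ 2) := by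
  constructor
  · intro hm z
    have := v.sum_repr z
    rw [Fin.sum_univ_two] at this
    rw [← this, Submodule.coe_add, Submodule.coe_smul, Submodule.coe_smul, h]
    exact hm.mul_right _
  · intro hz
    have key : ∀ x y : ℤ, m ∣ n * Q.eval x y := by
      intro x y
      rw [← h]
      simpa using hz (x • v 0 + y • v 1)
    have h1 := key 1 0
    have h2 := key 0 1
    have h3 := key 1 1
    simp only [BinQuadForm.eval] at h1 h2 h3
    have hr : m ∣ n * Q.r := by simpa using h1
    have ht : m ∣ n * Q.t := by simpa using h2
    have hs : m ∣ n * Q.s := by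
      have := (h3.sub hr).sub ht
      ring_nf at this
      exact this
    have hg : IsUnit ((BinQuadForm.content Q : ℕ) : ℤ) := by
      obtain ⟨a, b, c⟩ := BinQuadForm.dvd_content.1 (dvd_refl (Q.content : ℤ))
      exact hQ _ a b c
    have hg1 : Q.content = 1 := by
      rw [Int.isUnit_iff] at hg
      omega
    -- By Bézout, primitivity makes `n` an integral combination of `n r`, `n s`, `n t`.
    obtain ⟨a, b, hab⟩ : ∃ a b : ℤ, (1 : ℤ) = Q.r * a + (Int.gcd Q.s Q.t : ℤ) * b :=
      ⟨_, _, by rw [← Int.gcd_eq_gcd_ab, ← BinQuadForm.content, hg1]; rfl⟩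
    have hst : m ∣ n * (Int.gcd Q.s Q.t : ℤ) := by
      rw [Int.gcd_eq_gcd_ab, mul_add, ← mul_assoc, ← mul_assoc]
      exact (hs.mul_right _).add (ht.mul_right _)
    have : n = n * Q.r * a + n * (Int.gcd Q.s Q.t : ℤ) * b := by
      linear_combination n * hab
    rw [this]
    exact (hr.mul_right _).add (hst.mul_right _)

/-- The discriminant of the shape is the discriminant of the Hessian divided by the square of its
content. -/
theorem hasShapeOfDisc_iff {f : BinCubicForm} (hf : IsIndexForm R f) (h0 : f.disc ≠ 0) (D : ℤ) :
    HasShapeOfDisc R D ↔ D * (f.hessian.content : ℤ) ^ 2 = -3 * f.disc := by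
  obtain ⟨B, hB⟩ := hf
  obtain ⟨v, hv0, hv1⟩ := hB.exists_basis_traceZeroLattice
  have hk := BinCubicForm.content_hessian_ne_zero h0
  have hk' : (f.hessian.content : ℤ) ≠ 0 := by exact_mod_cast hk
  obtain ⟨Q, hQ, hr, hs, ht⟩ := BinQuadForm.exists_isPrimitive hk
  have hdisc : Q.disc * (f.hessian.content : ℤ) ^ 2 = -3 * f.disc := by
    rw [← BinCubicForm.disc_hessian, BinQuadForm.disc_mul_sq hr hs ht]
  have htr : ∀ x y : ℤ, Algebra.trace ℤ R ((x • (v 0 : R) + y • (v 1 : R)) ^ 2) =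
      (6 * f.hessian.content : ℤ) * Q.eval x y := by
    intro x y
    rw [hv0, hv1, hB.trace_sq, BinQuadForm.eval, BinQuadForm.eval, hr, hs, ht]
    ring
  have hn : (0 : ℤ) < 6 * f.hessian.content := by positivity
  constructor
  · rintro ⟨Q', ⟨hQ', v', n, hn', h'⟩, rfl⟩
    -- The divisors of either multiplier are described by the trace form without reference to a
    -- basis.
    have hnn : n = 6 * f.hessian.content := by
      have h1 := dvd_multiplier_iff hQ htr
      have h2 := dvd_multiplier_iff hQ' h'
      exact Int.dvd_antisymm hn'.le hn.le ((h1 n).2 ((h2 n).1 dvd_rfl))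
        ((h2 _).2 ((h1 _).1 dvd_rfl))
    obtain ⟨p, q, r, s, e0, e1, hu⟩ := v.exists_transition v'
    have := BinQuadForm.disc_of_eval_eq (Q := Q) (Q' := Q') (n := 6 * f.hessian.content) (n' := n)
      (p := p) (q := q) (r := r) (s := s) (by
        intro x y
        rw [← h', ← htr, e0, e1]
        congr 2
        simp only [Submodule.coe_add, Submodule.coe_smul, zsmul_eq_mul]
        push_cast
        ring)
    rw [hu, mul_one, hnn] at this
    rw [mul_left_cancel₀ (pow_ne_zero 2 hn.ne') this, hdisc]
  · intro hD
    refine ⟨Q, ⟨hQ, v, _, hn, htr⟩, ?_⟩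
    exact mul_right_cancel₀ (pow_ne_zero 2 hk') (hdisc.trans hD.symm)

variable {f : BinCubicForm}

/-- If `p` divides the discriminant, some index form has a double root at `(1, 0)` modulo `p`. -/
theorem IsIndexForm.exists_double_root (hf : IsIndexForm R f) {p : ℕ} (hp : p.Prime)
    (h : (p : ℤ) ∣ f.disc) : ∃ g, IsIndexForm R g ∧ (p : ℤ) ∣ g.a ∧ (p : ℤ) ∣ g.b := by
  obtain ⟨h1, h2⟩ | ⟨s, h1, h2⟩ := BinCubicForm.exists_double_root hp h
  · exact ⟨f.swap, hf.swap, h1.neg_right, h2.neg_right⟩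
  · exact ⟨f.shear s, hf.shear s, h1, h2⟩

/-- The content of the Hessian does not depend on the index form. -/
theorem IsIndexForm.content_hessian_eq {g : BinCubicForm} (hf : IsIndexForm R f)
    (hg : IsIndexForm R g) (h0 : f.disc ≠ 0) (h : f.disc = g.disc) :
    f.hessian.content = g.hessian.content := by
  obtain ⟨Q, hQ, hr, hs, ht⟩ :=
    BinQuadForm.exists_isPrimitive (BinCubicForm.content_hessian_ne_zero h0)
  have hdisc : Q.disc * (f.hessian.content : ℤ) ^ 2 = -3 * f.disc := by
    rw [← BinCubicForm.disc_hessian, BinQuadForm.disc_mul_sq hr hs ht]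
  have hD := (hasShapeOfDisc_iff hg (h ▸ h0) Q.disc).1 ((hasShapeOfDisc_iff hf h0 Q.disc).2 hdisc)
  rw [← h, ← hdisc] at hD
  have hQ0 : Q.disc ≠ 0 := by
    intro hQ0
    rw [hQ0] at hdisc
    omega
  have := mul_left_cancel₀ hQ0 hD
  have := (sq_eq_sq₀ (by positivity) (by positivity)).1 this
  exact_mod_cast this.symm

end Shape

/-! ### Maximality of the ring of integers. -/

section MaximalOrder

variable {K : Type*} [Field K] [NumberField K]

theorem IsIndexForm.disc_eq_discr {f : BinCubicForm} (hf : IsIndexForm (𝓞 K) f) :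
    f.disc = NumberField.discr K := by
  obtain ⟨B, hB⟩ := hf
  rw [← hB.discr_eq]
  exact NumberField.discr_eq_discr K B

/-- An algebraic integer `w` is divisible by `p` if `w / p` is a root of a monic integral cubic. -/
theorem exists_eq_mul_of_cubic {w : 𝓞 K} {p a b c : ℤ} (hp : p ≠ 0)
    (h : w ^ 3 + p * a * w ^ 2 + p ^ 2 * b * w + p ^ 3 * c = 0) : ∃ y : 𝓞 K, w = p * y := by
  have hpK : (p : K) ≠ 0 := by exact_mod_cast hp
  have hK : (w : K) ^ 3 + p * a * (w : K) ^ 2 + p ^ 2 * b * w + p ^ 3 * c = 0 := by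
    have := congrArg (algebraMap (𝓞 K) K) h
    simpa using this
  have hint : IsIntegral ℤ ((w : K) / p) := by
    refine ⟨Polynomial.X ^ 3 + (Polynomial.C a * Polynomial.X ^ 2 + Polynomial.C b * Polynomial.X +
      Polynomial.C c), ?_, ?_⟩
    · refine Polynomial.monic_X_pow_add ?_
      exact (Polynomial.degree_quadratic_le).trans_lt (by norm_num)
    · simp only [Polynomial.eval₂_add, Polynomial.eval₂_pow, Polynomial.eval₂_X,
        Polynomial.eval₂_mul, Polynomial.eval₂_C]
      simp only [eq_intCast]
      field_simp
      linear_combination hK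
  obtain ⟨y, hy⟩ : ∃ y : 𝓞 K, (y : K) = (w : K) / p := ⟨⟨_, hint⟩, rfl⟩
  refine ⟨y, NumberField.RingOfIntegers.ext ?_⟩
  have : algebraMap (𝓞 K) K (p * y) = p * y := by rw [map_mul, map_intCast]
  refine Eq.trans ?_ this.symm
  rw [hy]
  field_simp

/-- Maximality of the ring of integers in terms of the index form. -/
theorem IsIndexForm.maximal {f : BinCubicForm} (hf : IsIndexForm (𝓞 K) f) {p : ℕ} (hp : p.Prime)
    (hb : (p : ℤ) ∣ f.b) (hac : (p : ℤ) ^ 2 ∣ f.a * f.c) (hae : (p : ℤ) ^ 3 ∣ f.a ^ 2 * f.e) :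
    False := by
  obtain ⟨B, hB⟩ := hf
  obtain ⟨b, hb⟩ := hb
  obtain ⟨c, hc⟩ := hac
  obtain ⟨e, he⟩ := hae
  have hb' : (f.b : 𝓞 K) = p * b := by exact_mod_cast congrArg (Int.cast : ℤ → 𝓞 K) hb
  have hc' : (f.a * f.c : 𝓞 K) = p ^ 2 * c := by exact_mod_cast congrArg (Int.cast : ℤ → 𝓞 K) hc
  have he' : (f.a ^ 2 * f.e : 𝓞 K) = p ^ 3 * e := by
    exact_mod_cast congrArg (Int.cast : ℤ → 𝓞 K) he
  have hp0 : (p : ℤ) ≠ 0 := by exact_mod_cast hp.ne_zero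
  -- `B 1` is a root of `X³ - bX² + acX - a²e` (coefficients of `f`), so the hypotheses make `B 1 /
  -- p` integral, which is impossible for a basis element.
  obtain ⟨y, hy⟩ := exists_eq_mul_of_cubic (w := B 1) (a := -b) (b := c) (c := -e) hp0 (by
    push_cast
    linear_combination B 1 * hB.sq_one - f.a * hB.mul + B 1 ^ 2 * hb' - B 1 * hc' + he')
  obtain ⟨r, s, t, rfl⟩ := B.exists_coords hB.zero y
  obtain ⟨-, h1, -⟩ := B.coords_eq_zero hB.zero (x := p * r) (y := p * s - 1) (w := p * t)
    (by push_cast at hy ⊢; linear_combination -hy)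
  have hpi : Prime (p : ℤ) := Nat.prime_iff_prime_int.mp hp
  exact hpi.not_isUnit (IsUnit.of_mul_eq_one s (by linarith))

/-- The rational integers are saturated in a ring of integers. -/
theorem NumberField.RingOfIntegers.mem_span_one_of_smul {n : ℤ} (hn : n ≠ 0) {z : 𝓞 K}
    (h : n • z ∈ Submodule.span ℤ {(1 : 𝓞 K)}) : z ∈ Submodule.span ℤ {(1 : 𝓞 K)} := by
  obtain ⟨m, hm⟩ := Submodule.mem_span_singleton.1 h
  have hnK : (n : K) ≠ 0 := by exact_mod_cast hn
  have hmK : (m : K) = n * z := by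
    have := congrArg (algebraMap (𝓞 K) K) hm
    simpa using this
  have hz : algebraMap ℚ K (m / n : ℚ) = z := by
    simp only [map_div₀, map_intCast]
    rw [hmK]
    field_simp
  have hint : IsIntegral ℤ (m / n : ℚ) := by
    have : IsIntegral ℤ (algebraMap ℚ K (m / n : ℚ)) := hz ▸ z.isIntegral_coe
    exact (isIntegral_algebraMap_iff (algebraMap ℚ K).injective).1 this
  obtain ⟨k, hk⟩ := IsIntegrallyClosed.isIntegral_iff.1 hint
  refine Submodule.mem_span_singleton.2 ⟨k, ?_⟩
  apply NumberField.RingOfIntegers.ext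
  rw [← hz, ← hk]
  simp

/-- The ring of integers of a cubic field has an index form. -/
theorem NumberField.exists_isIndexForm (hK : Module.finrank ℚ K = 3) :
    ∃ f, IsIndexForm (𝓞 K) f := by
  let W : Submodule ℤ (𝓞 K) := Submodule.span ℤ {(1 : 𝓞 K)}
  have hli : LinearIndependent ℤ (fun _ : Fin 1 => (1 : 𝓞 K)) := by
    rw [linearIndependent_unique_iff]
    exact one_ne_zero
  have hW : Submodule.span ℤ (Set.range fun _ : Fin 1 => (1 : 𝓞 K)) = W := by
    rw [Set.range_const]
  let bW : Module.Basis (Fin 1) ℤ W := (Module.Basis.span hli).map (LinearEquiv.ofEq _ _ hW)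
  have hbW : (bW 0 : 𝓞 K) = 1 := by
    simp [bW, Module.Basis.span_apply]
  -- Torsion-freeness of `𝓞 K / ℤ` is what lets `1` be completed to a basis.
  have : Module.IsTorsionFree ℤ (𝓞 K ⧸ W) := by
    refine Module.IsTorsionFree.of_smul_eq_zero fun n z hz => ?_
    obtain ⟨z, rfl⟩ := Submodule.Quotient.mk_surjective W z
    rw [or_iff_not_imp_left]
    intro hn
    rw [← Submodule.Quotient.mk_smul, Submodule.Quotient.mk_eq_zero] at hz
    exact (Submodule.Quotient.mk_eq_zero W).2
      (NumberField.RingOfIntegers.mem_span_one_of_smul hn hz)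
  have hfree : Module.Free ℤ (𝓞 K ⧸ W) := Module.free_of_finite_type_torsion_free'
  have hrank : Module.finrank ℤ (𝓞 K ⧸ W) = 2 := by
    have h1 := Submodule.finrank_quotient_add_finrank W
    rw [Module.finrank_eq_card_basis bW, NumberField.RingOfIntegers.rank, hK] at h1
    simpa using h1
  let bQ := Module.finBasisOfFinrankEq ℤ (𝓞 K ⧸ W) hrank
  let B : Module.Basis (Fin 3) ℤ (𝓞 K) := (Module.Basis.sumQuot bW bQ).reindex finSumFinEquiv
  refine _root_.exists_isIndexForm B ?_
  have : (finSumFinEquiv (m := 1) (n := 2)).symm 0 = Sum.inl 0 := by decide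
  rw [Module.Basis.reindex_apply, this, Module.Basis.sumQuot_inl, hbW]

variable {f : BinCubicForm}

/-- If `Disc = d u²` with `d ≡ 0, 1 (mod 4)`, then `u` divides the content of the Hessian. -/
theorem IsIndexForm.dvd_content_hessian (hf : IsIndexForm (𝓞 K) f) {d : ℤ} {u : ℕ}
    (hd : d % 4 = 0 ∨ d % 4 = 1) (h : f.disc = d * (u : ℤ) ^ 2) : u ∣ f.hessian.content := by
  rw [Nat.dvd_iff_prime_pow_dvd_dvd]
  intro p k hp hk
  obtain rfl | hk0 := Nat.eq_zero_or_pos k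
  · simp
  have hpu : p ∣ u := (dvd_pow_self p hk0.ne').trans hk
  have hpu' : (p : ℤ) ∣ u := Int.natCast_dvd_natCast.2 hpu
  have h0 : f.disc ≠ 0 := hf.disc_eq_discr ▸ NumberField.discr_ne_zero K
  obtain ⟨g, hg, ha, hb⟩ := hf.exists_double_root hp
    (h ▸ (dvd_pow hpu' two_ne_zero).mul_left d)
  have hfg : f.disc = g.disc := hf.disc_eq_discr.trans hg.disc_eq_discr.symm
  rw [hf.content_hessian_eq hg h0 hfg]
  rw [hfg] at h
  -- Maximality is used twice: first to exclude `p² ∣ a`, then, once the root is known to be triple,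
  -- to exclude `p ∣ e`.
  have ha2 : ¬ (p : ℤ) ^ 2 ∣ g.a := by
    intro ha2
    refine hg.maximal hp hb (ha2.mul_right _) (Dvd.dvd.mul_right ?_ _)
    exact (pow_dvd_pow _ (by norm_num : 3 ≤ 2 * 2)).trans
      (by rw [pow_mul]; exact pow_dvd_pow_of_dvd ha2 2)
  have hc := BinCubicForm.dvd_c_of_dvd_sqrt hp hd ha hb ha2 h hpu'
  have he : ¬ (p : ℤ) ∣ g.e := by
    intro he
    refine hg.maximal hp hb ?_ ?_
    · rw [sq]; exact mul_dvd_mul ha hc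
    · rw [pow_succ]; exact mul_dvd_mul (pow_dvd_pow_of_dvd ha 2) he
  by_cases hp3 : p = 3
  · subst hp3
    have hk2 : k ≤ 2 := by
      by_contra hk3
      refine BinCubicForm.not_twentySeven_dvd_sqrt ha hb hc he ha2 h ?_
      exact_mod_cast (pow_dvd_pow 3 (by omega : 3 ≤ k)).trans hk
    refine (pow_dvd_pow 3 hk2).trans ?_
    exact_mod_cast BinCubicForm.nine_dvd_content_hessian ha hb hc
  · have hk1 : k ≤ 1 := by
      by_contra hk2
      refine BinCubicForm.not_sq_dvd_sqrt hp hp3 ha hb hc he ha2 h ?_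
      exact_mod_cast (pow_dvd_pow p (by omega : 2 ≤ k)).trans hk
    refine (pow_dvd_pow p hk1).trans ?_
    rw [pow_one]
    exact_mod_cast BinCubicForm.dvd_content_hessian ha hb hc

end MaximalOrder

/-! ### Comparison of the fields `ℚ(√m)`. -/

theorem exists_rat_of_mem_sqrtField {m : ℤ} {w z : ℂ} (hw : w ^ 2 = m) (hz : z ∈ sqrtField m) :
    ∃ x y : ℚ, z = x + y * w := by
  have hset : {z : ℂ | z ^ 2 = (m : ℂ)} ⊆ (IntermediateField.adjoin ℚ {w} : Set ℂ) := by
    intro t ht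
    have hwmem := IntermediateField.mem_adjoin_simple_self ℚ w
    have ht' : t ^ 2 = m := ht
    rcases sq_eq_sq_iff_eq_or_eq_neg.1 (ht'.trans hw.symm) with rfl | rfl
    · exact hwmem
    · exact neg_mem hwmem
  have hz' : z ∈ IntermediateField.adjoin ℚ {w} :=
    (IntermediateField.adjoin_le_iff.2 hset) hz
  have hint : IsIntegral ℚ w := by
    refine ⟨Polynomial.X ^ 2 - Polynomial.C (m : ℚ), Polynomial.monic_X_pow_sub_C _ two_ne_zero, ?_⟩
    simp only [Polynomial.eval₂_sub, Polynomial.eval₂_pow, Polynomial.eval₂_X, Polynomial.eval₂_C]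
    simp [hw]
  rw [← IntermediateField.mem_toSubalgebra,
    IntermediateField.adjoin_simple_toSubalgebra_of_isAlgebraic hint.isAlgebraic] at hz'
  clear hz
  induction hz' using Algebra.adjoin_induction with
  | mem x hx => exact ⟨0, 1, by rw [Set.mem_singleton_iff.1 hx]; simp⟩
  | algebraMap r => exact ⟨r, 0, by simp⟩
  | add u v _ _ hu hv =>
    obtain ⟨x, y, rfl⟩ := hu
    obtain ⟨x', y', rfl⟩ := hv
    exact ⟨x + x', y + y', by push_cast; ring⟩
  | mul u v _ _ hu hv =>
    obtain ⟨x, y, rfl⟩ := hu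
    obtain ⟨x', y', rfl⟩ := hv
    exact ⟨x * x' + m * y * y', x * y' + x' * y, by
      push_cast; linear_combination (y * y' : ℂ) * hw⟩

theorem sqrtField_le {m d : ℤ} {q : ℚ} (h : (m : ℚ) = d * q ^ 2) : sqrtField m ≤ sqrtField d := by
  refine IntermediateField.adjoin_le_iff.2 fun z hz => ?_
  obtain ⟨w, hw⟩ := IsAlgClosed.exists_pow_nat_eq (d : ℂ) two_pos
  have hm : (m : ℂ) = d * (q : ℂ) ^ 2 := by exact_mod_cast congrArg (Rat.cast : ℚ → ℂ) h
  have hwq : w * q ∈ sqrtField d :=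
    mul_mem (IntermediateField.subset_adjoin _ _ hw) (algebraMap_mem (sqrtField d) q)
  have hz' : z ^ 2 = m := hz
  have hz2 : z ^ 2 = (w * q) ^ 2 := by
    rw [hz', hm, mul_pow, hw]
  rcases sq_eq_sq_iff_eq_or_eq_neg.1 hz2 with rfl | rfl
  · exact hwq
  · exact neg_mem hwq

/-- `ℚ(√m) = ℚ(√d)` if and only if `m / d` is a square. -/
theorem sqrtField_eq_iff {m d : ℤ} (hm : m ≠ 0) (hd : d ≠ 0) :
    sqrtField m = sqrtField d ↔ ∃ q : ℚ, (m : ℚ) = d * q ^ 2 := by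
  constructor
  · intro h
    obtain ⟨w, hw⟩ := IsAlgClosed.exists_pow_nat_eq (d : ℂ) two_pos
    obtain ⟨z, hz⟩ := IsAlgClosed.exists_pow_nat_eq (m : ℂ) two_pos
    have hzd : z ∈ sqrtField d := h ▸ IntermediateField.subset_adjoin _ _ hz
    have hwm : w ∈ sqrtField m := h ▸ IntermediateField.subset_adjoin _ _ hw
    -- Squares are allowed for `d` and `m`, so rational roots need their own case. Squaring `z = x +
    -- y w` shows that `w` is rational when `x y ≠ 0`.
    have hrat : ∀ r t : ℚ, w = r → z = t → ∃ q : ℚ, (m : ℚ) = d * q ^ 2 := by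
      rintro r t rfl rfl
      have hw' : r ^ 2 = d := by exact_mod_cast hw
      have hz' : t ^ 2 = m := by exact_mod_cast hz
      have hr : r ≠ 0 := by
        rintro rfl
        apply hd
        exact_mod_cast (by simpa using hw'.symm : (d : ℚ) = 0)
      refine ⟨t / r, ?_⟩
      rw [← hw', ← hz']
      field_simp
    obtain ⟨x, y, hxy⟩ := exists_rat_of_mem_sqrtField hw hzd
    obtain ⟨x', y', hxy'⟩ := exists_rat_of_mem_sqrtField hz hwm
    by_cases hy : y = 0
    · subst hy
      refine hrat (x' + y' * x) x ?_ (by simpa using hxy)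
      rw [hxy', hxy]
      push_cast
      ring
    by_cases hx : x = 0
    · subst hx
      refine ⟨y, ?_⟩
      have : (m : ℂ) = d * (y : ℂ) ^ 2 := by
        rw [← hz, ← hw, hxy]
        push_cast
        ring
      exact_mod_cast this
    · have hxC : (x : ℂ) ≠ 0 := by exact_mod_cast hx
      have hyC : (y : ℂ) ≠ 0 := by exact_mod_cast hy
      have hwr : w = (((m - x ^ 2 - d * y ^ 2) / (2 * x * y) : ℚ) : ℂ) := by
        push_cast
        field_simp
        rw [← hz, ← hw, hxy]
        ring
      refine hrat _ (x + y * ((m - x ^ 2 - d * y ^ 2) / (2 * x * y))) hwr ?_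
      rw [hxy, hwr]
      push_cast
      ring
  · rintro ⟨q, hq⟩
    refine le_antisymm (sqrtField_le hq) (sqrtField_le (q := q⁻¹) ?_)
    have hq0 : q ≠ 0 := by
      rintro rfl
      apply hm
      exact_mod_cast (by simpa using hq : (m : ℚ) = 0)
    rw [hq]
    field_simp

/-! ### Resolvents, shapes and the count of cubic fields. -/

namespace CubicField

theorem discr_ne_zero (K : CubicField) : NumberField.discr K ≠ 0 := NumberField.discr_ne_zero K

/-- The quadratic resolvent determines the discriminant of the shape. -/
theorem quadraticResolvent_eq_iff (K : CubicField) {d : ℤ} (hd : IsFundamentalDiscriminant d) :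
    K.quadraticResolvent = sqrtField d ↔
      HasShapeOfDisc (𝓞 K) (-3 * d) ∨ (3 ∣ d ∧ HasShapeOfDisc (𝓞 K) (-(d / 3))) := by
  obtain ⟨f, hf⟩ := NumberField.exists_isIndexForm K.finrank_eq
  have hdisc := hf.disc_eq_discr
  have h0 : f.disc ≠ 0 := hdisc ▸ K.discr_ne_zero
  rw [quadraticResolvent, ← hdisc, sqrtField_eq_iff h0 hd.ne_zero, hasShapeOfDisc_iff hf h0,
    hasShapeOfDisc_iff hf h0]
  constructor
  · rintro ⟨q, hq⟩
    obtain ⟨u, hu⟩ := hd.exists_eq_mul_sq f.disc_emod_four hq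
    obtain ⟨j, hj⟩ := hf.dvd_content_hessian hd.emod_four hu
    have hu0 : (u : ℤ) ≠ 0 := by
      intro h
      rw [h] at hu
      simp [h0] at hu
    obtain ⟨Q, -, hr, hs, ht⟩ :=
      BinQuadForm.exists_isPrimitive (BinCubicForm.content_hessian_ne_zero h0)
    have hQ : -3 * f.disc = Q.disc * (f.hessian.content : ℤ) ^ 2 := by
      rw [← BinCubicForm.disc_hessian, BinQuadForm.disc_mul_sq hr hs ht]
    -- Cancelling `u²` leaves an equation in which `d` being fundamental restricts `j`.
    have hdQ : -3 * d = Q.disc * (j : ℤ) ^ 2 := by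
      rw [hu, hj] at hQ
      refine mul_right_cancel₀ (pow_ne_zero 2 hu0) ?_
      push_cast at hQ
      linear_combination hQ
    rw [hj, hu]
    obtain rfl | ⟨rfl, i, rfl⟩ := hd.eq_one_or_three Q.disc_emod_four hdQ
    · left
      push_cast
      ring
    · refine Or.inr ⟨dvd_mul_right _ _, ?_⟩
      rw [Int.mul_ediv_cancel_left _ (by norm_num)]
      push_cast
      ring
  · rintro (h | ⟨⟨i, rfl⟩, h⟩)
    · refine ⟨f.hessian.content, ?_⟩
      have : f.disc = d * (f.hessian.content : ℤ) ^ 2 := by linarith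
      exact_mod_cast this
    · rw [Int.mul_ediv_cancel_left _ (by norm_num)] at h
      -- With `d = 3i` the shape relation reads `3 Disc = i k²`, that is `Disc = d (k/3)²`; the
      -- division is in `ℚ`.
      refine ⟨f.hessian.content / 3, ?_⟩
      have : 3 * f.disc = i * (f.hessian.content : ℤ) ^ 2 := by linarith
      have : (3 : ℚ) * f.disc = i * (f.hessian.content : ℚ) ^ 2 := by exact_mod_cast this
      push_cast
      linarith

/-- Isomorphic cubic fields have the same shape discriminant. -/
theorem eq_of_hasShapeOfDisc {K L : CubicField} (h : K ≈ L) {D E : ℤ}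
    (hK : HasShapeOfDisc (𝓞 K) D) (hL : HasShapeOfDisc (𝓞 L) E) : D = E := by
  obtain ⟨φ⟩ := h
  obtain ⟨f, hf⟩ := NumberField.exists_isIndexForm K.finrank_eq
  have h0 : f.disc ≠ 0 := hf.disc_eq_discr ▸ K.discr_ne_zero
  have hfL := hf.of_ringEquiv (NumberField.RingOfIntegers.mapRingEquiv φ)
  rw [hasShapeOfDisc_iff hf h0] at hK
  rw [hasShapeOfDisc_iff hfL h0] at hL
  have hk : (f.hessian.content : ℤ) ≠ 0 := by
    exact_mod_cast BinCubicForm.content_hessian_ne_zero h0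
  exact mul_right_cancel₀ (pow_ne_zero 2 hk) (hK.trans hL.symm)

/-- **Hermite's theorem** for isomorphism classes of cubic fields. -/
theorem finite_of_discr_lt (X : ℝ) :
    {c : Quotient isoSetoid | ∃ K : CubicField, ⟦K⟧ = c ∧
      |(NumberField.discr K : ℝ)| < X}.Finite := by
  obtain ⟨N, hN⟩ := exists_nat_ge X
  refine ((NumberField.finite_of_discr_bdd ℂ N).biUnion (t := fun F =>
    {c : Quotient isoSetoid | ∃ h : Module.finrank ℚ F.1 = 3,
      ⟦@CubicField.mk F.1 _ (@NumberField.mk _ _ inferInstance F.2) h⟧ = c}) ?_).subset ?_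
  · rintro F -
    refine Set.Subsingleton.finite ?_
    rintro c ⟨h, rfl⟩ c' ⟨h', rfl⟩
    rfl
  · rintro c ⟨K, rfl, hK⟩
    -- Hermite's theorem concerns subfields of a fixed field, so `K` is replaced by its image in
    -- `ℂ`.
    let ι : K →ₐ[ℚ] ℂ := IsAlgClosed.lift
    let e : K ≃ₐ[ℚ] ι.fieldRange := AlgEquiv.ofInjectiveField ι
    have hfin : FiniteDimensional ℚ ι.fieldRange := e.toLinearEquiv.finiteDimensional
    have hnf : NumberField ι.fieldRange := @NumberField.mk _ _ inferInstance hfin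
    have hdisc := NumberField.discr_eq_discr_of_algEquiv K e
    refine Set.mem_biUnion (x := ⟨ι.fieldRange, hfin⟩) ?_ ⟨?_, ?_⟩
    · change |NumberField.discr ι.fieldRange| ≤ N
      rw [← hdisc]
      have : |(NumberField.discr K : ℝ)| ≤ N := hK.le.trans hN
      exact_mod_cast this
    · exact e.toLinearEquiv.finrank_eq.symm.trans K.finrank_eq
    · exact Quotient.sound ⟨e.symm.toRingEquiv⟩

end CubicField

theorem theorem6 (d : ℤ) (hd : IsFundamentalDiscriminant d) (hd3 : d ≠ -3) (X : ℝ) :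
    resolventCount d X < ⊤ ∧
    (¬ 3 ∣ d → resolventCount d X = shapeCount (-3 * d) X) ∧
    (3 ∣ d → resolventCount d X = shapeCount (-3 * d) X + shapeCount (-(d / 3)) X) := by
  refine ⟨?_, ?_, ?_⟩
  · rw [resolventCount, countCubicFields, Set.encard_lt_top_iff]
    refine (CubicField.finite_of_discr_lt X).subset ?_
    rintro c ⟨K, hc, hK, -⟩
    exact ⟨K, hc, hK⟩
  · intro h
    simp only [resolventCount, shapeCount, CubicField.quadraticResolvent_eq_iff _ hd, h, false_and,
      or_false]
  · intro h
    rw [shapeCount, shapeCount, countCubicFields, countCubicFields, ← Set.encard_union_eq]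
    · simp only [resolventCount, countCubicFields, CubicField.quadraticResolvent_eq_iff _ hd, h,
        true_and, and_or_left, exists_or]
      rfl
    -- A common class would give `-3d = -(d/3)`, forcing `d = 0`.
    · rw [Set.disjoint_left]
      rintro c ⟨K, rfl, -, hK⟩ ⟨L, hL, -, hL'⟩
      have := CubicField.eq_of_hasShapeOfDisc (Quotient.exact hL) hL' hK
      have := hd.ne_zero
      omega
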